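/- Let $\alpha,\beta,\gamma\in\{1,2,\infty\}$, $\mu_1,\mu_2\ge 0$, $\rho\in\mathbb{R}$, $b\in\mathbb{R}^q$, $d\in\mathbb{R}^p$, and let $\mathcal{A}:\mathbb{R}^{m\times n}\to\mathbb{R}^q$ and $\mathcal{C}:\mathbb{R}^{m\times n}\to\mathbb{R}^p$ be linear with $\mathcal{A}$ surjective. Write $\sigma(X)\in\mathbb{R}^{\min\{m,n\}}$ for the vector of singular values of $X$. Suppose that the composite norm minimization problem $$\min_{X\in\mathbb{R}^{m\times n}}\ \mu_1\|\sigma(X)\|_\alpha+\mu_2\|\mathcal{C}(X)-d\|_\beta\quad\text{subject to}\quad \|\mathcal{A}(X)-b\|_\gamma\le\rho$$ has a unique optimal solution $X_*$. Let $\lambda^{(k)}>0$, $\epsilon^{(k)},\tau^{(k)},\xi^{(k)}$ ($k\ge1$) be real sequences, each decreasing monotonically to $0$, such that $\epsilon^{(k)}/(\lambda^{(k)})^2\le B$ for all $k\ge 1$ and some $B>0$, and $\tau^{(k)}/\lambda^{(k)}\to0$, $\xi^{(k)}/\lambda^{(k)}\to0$. Let $(X^{(k)},s^{(k)},y^{(k)})_{k\ge0}$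 be generated by the first-order augmented Lagrangian algorithm (FALC): $X^{(0)},s^{(0)},y^{(0)}$ are given, $\theta_1^{(1)}=0$, $\theta_2^{(1)}=0$, and for every $k\ge1$, with $$P^{(k)}(X,s,y)=\lambda^{(k)}\big(\mu_1\|\sigma(X)\|_\alpha+\mu_2\|s\|_\beta\big)+\tfrac12\|\mathcal{A}(X)+y-b-\lambda^{(k)}\theta_1^{(k)}\|_2^2+\tfrac12\|\mathcal{C}(X)+s-d-\lambda^{(k)}\theta_2^{(k)}\|_2^2$$ and $$\eta^{(k)}=\mu_1\|\sigma(X^{(0)})\|_\alpha+\mu_2\|\mathcal{C}(X^{(0)})-d\|_\beta+\tfrac{\lambda^{(k)}}{2}\big(\|\theta_1^{(k)}\|_2^2+\|\theta_2^{(k)}\|_2^2\big),$$ the point $(X^{(k)},s^{(k)},y^{(k)})\in\mathbb{R}^{m\times n}\times\mathbb{R}^p\times\mathbb{R}^q$ satisfies $\|y^{(k)}\|_\gamma\le\rho$ and at least one of the two conditions (a) $P^{(k)}(X^{(k)},s^{(k)},y^{(k)})\le\inf\{P^{(k)}(X,s,y): X\in\mathbb{R}^{m\times n},\ s\in\mathbb{R}^p,\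 \|y\|_\gamma\le\rho\}+\epsilon^{(k)}$; (b) there is a partial subgradient $(G,g)\in\partial_{X,s}P^{(k)}(\cdot,\cdot,\cdot)|_{(X^{(k)},s^{(k)},y^{(k)})}$, i.e. a subgradient of $P^{(k)}(\cdot,\cdot,y^{(k)})$ at $(X^{(k)},s^{(k)})$, with $\sqrt{\|G\|_F^2+\|g\|_2^2}\le\tau^{(k)}$; moreover $\rho\|v\|_{\gamma^*}+v^Ty^{(k)}\le\xi^{(k)}$ for $v=\nabla_yP^{(k)}(X^{(k)},s^{(k)},y^{(k)})$, where $\|\cdot\|_{\gamma^*}$ is the dual norm of $\|\cdot\|_\gamma$; and $\mu_1\|\sigma(X^{(k)})\|_\alpha\le\eta^{(k)}$; and $$\theta_1^{(k+1)}=\theta_1^{(k)}-\frac{\mathcal{A}(X^{(k)})+y^{(k)}-b}{\lambda^{(k)}},\qquad \theta_2^{(k+1)}=\theta_2^{(k)}-\frac{\mathcal{C}(X^{(k)})+s^{(k)}-d}{\lambda^{(k)}}.$$ Then the whole sequence converges: $\lim_{k\to\infty}X^{(k)}=X_*$. -/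

import Mathlib

open Filter Topology
open scoped ENNReal Gradient

noncomputable section

namespace FALC

/-- The `ℓ_r` norm of a real vector, `r ∈ {1, 2, ∞}`. -/
def vecNorm {l : ℕ} (r : ℝ≥0∞) (x : Fin l → ℝ) : ℝ :=
  ‖(WithLp.toLp r x : PiLp r (fun _ : Fin l => ℝ))‖

/-- The dual norm `max {⟨w, x⟩ : ‖w‖_r ≤ 1}` of `‖·‖_r`. -/
def dualVecNorm {l : ℕ} (r : ℝ≥0∞) (x : EuclideanSpace ℝ (Fin l)) : ℝ :=
  sSup {t : ℝ | ∃ w : EuclideanSpace ℝ (Fin l), vecNorm r w.ofLp ≤ 1 ∧ t = inner ℝ w x}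

/-- The vector `σ(X) ∈ ℝ^{min(m,n)}` of singular values of `X ∈ ℝ^{m×n}`. -/
def singVals {m n : ℕ} (X : Matrix (Fin m) (Fin n) ℝ) : Fin (min m n) → ℝ :=
  fun i => (Matrix.toEuclideanLin X).singularValues i

/-- The matrix norm `‖σ(X)‖_r`: nuclear (`r = 1`), Frobenius (`r = 2`) or operator (`r = ∞`). -/
def sigmaNorm {m n : ℕ} (r : ℝ≥0∞) (X : Matrix (Fin m) (Fin n) ℝ) : ℝ :=
  vecNorm r (singVals X)

/-- The inner product `⟨X, Y⟩ = Tr(Xᵀ Y)`. -/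
def matInner {m n : ℕ} (X Y : Matrix (Fin m) (Fin n) ℝ) : ℝ :=
  (X.transpose * Y).trace

section
open scoped Matrix.Norms.Frobenius

/-- The Frobenius norm. -/
def frobNorm {m n : ℕ} (X : Matrix (Fin m) (Fin n) ℝ) : ℝ := ‖X‖

end

/-- The data of the composite norm minimization problem
`min μ₁ ‖σ(X)‖_α + μ₂ ‖C(X) - d‖_β` subject to `‖A(X) - b‖_γ ≤ ρ`. -/
structure Problem (m n p q : ℕ) where
  A : Matrix (Fin m) (Fin n) ℝ →ₗ[ℝ] EuclideanSpace ℝ (Fin q)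
  C : Matrix (Fin m) (Fin n) ℝ →ₗ[ℝ] EuclideanSpace ℝ (Fin p)
  b : EuclideanSpace ℝ (Fin q)
  d : EuclideanSpace ℝ (Fin p)
  μ₁ : ℝ
  μ₂ : ℝ
  ρ : ℝ
  α : ℝ≥0∞
  β : ℝ≥0∞
  γ : ℝ≥0∞

namespace Problem

variable {m n p q : ℕ} (Q : Problem m n p q)

/-- The objective function `μ₁ ‖σ(X)‖_α + μ₂ ‖C(X) - d‖_β`. -/
def objective (X : Matrix (Fin m) (Fin n) ℝ) : ℝ :=
  Q.μ₁ * sigmaNorm Q.α X + Q.μ₂ * vecNorm Q.β (Q.C X - Q.d).ofLp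

/-- The feasible set `{X : ‖A(X) - b‖_γ ≤ ρ}`. -/
def feasible : Set (Matrix (Fin m) (Fin n) ℝ) :=
  {X | vecNorm Q.γ (Q.A X - Q.b).ofLp ≤ Q.ρ}

/-- `X` is an optimal solution of the composite norm minimization problem. -/
def IsOptimal (X : Matrix (Fin m) (Fin n) ℝ) : Prop :=
  X ∈ Q.feasible ∧ IsMinOn Q.objective Q.feasible X

/-- The smooth part
`f(X,s,y) = ½ ‖A(X) + y - b - λ θ₁‖₂² + ½ ‖C(X) + s - d - λ θ₂‖₂²` of a subproblem. -/
def smoothPart (lam : ℝ) (θ₁ : EuclideanSpace ℝ (Fin q)) (θ₂ : EuclideanSpace ℝ (Fin p))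
    (X : Matrix (Fin m) (Fin n) ℝ) (s : EuclideanSpace ℝ (Fin p))
    (y : EuclideanSpace ℝ (Fin q)) : ℝ :=
  1 / 2 * ‖Q.A X + y - Q.b - lam • θ₁‖ ^ 2 + 1 / 2 * ‖Q.C X + s - Q.d - lam • θ₂‖ ^ 2

/-- The augmented Lagrangian function `P(X,s,y) = λ (μ₁ ‖σ(X)‖_α + μ₂ ‖s‖_β) + f(X,s,y)`. -/
def augLag (lam : ℝ) (θ₁ : EuclideanSpace ℝ (Fin q)) (θ₂ : EuclideanSpace ℝ (Fin p))
    (X : Matrix (Fin m) (Fin n) ℝ) (s : EuclideanSpace ℝ (Fin p))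
    (y : EuclideanSpace ℝ (Fin q)) : ℝ :=
  lam * (Q.μ₁ * sigmaNorm Q.α X + Q.μ₂ * vecNorm Q.β s.ofLp) + Q.smoothPart lam θ₁ θ₂ X s y

/-- `(G, g) ∈ ∂_{X,s} P` at `(X, s, y)`: the subdifferential of `P(·, ·, y)` at `(X, s)`. -/
def IsPartialSubgradient (lam : ℝ) (θ₁ : EuclideanSpace ℝ (Fin q))
    (θ₂ : EuclideanSpace ℝ (Fin p)) (X : Matrix (Fin m) (Fin n) ℝ)
    (s : EuclideanSpace ℝ (Fin p)) (y : EuclideanSpace ℝ (Fin q))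
    (G : Matrix (Fin m) (Fin n) ℝ) (g : EuclideanSpace ℝ (Fin p)) : Prop :=
  ∀ (X' : Matrix (Fin m) (Fin n) ℝ) (s' : EuclideanSpace ℝ (Fin p)),
    Q.augLag lam θ₁ θ₂ X s y + matInner G (X' - X) + inner ℝ g (s' - s)
      ≤ Q.augLag lam θ₁ θ₂ X' s' y

/-- The partial gradient `∇_y P` at `(X, s, y)`. -/
def gradY (lam : ℝ) (θ₁ : EuclideanSpace ℝ (Fin q)) (θ₂ : EuclideanSpace ℝ (Fin p))
    (X : Matrix (Fin m) (Fin n) ℝ) (s : EuclideanSpace ℝ (Fin p))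
    (y : EuclideanSpace ℝ (Fin q)) : EuclideanSpace ℝ (Fin q) :=
  ∇ (fun y' => Q.augLag lam θ₁ θ₂ X s y') y

/-- Inner stopping condition (a): `(X, s, y)` minimizes `P` up to `ε` over all
`(X', s', y')` with `‖y'‖_γ ≤ ρ`. -/
def StopA (lam eps : ℝ) (θ₁ : EuclideanSpace ℝ (Fin q)) (θ₂ : EuclideanSpace ℝ (Fin p))
    (X : Matrix (Fin m) (Fin n) ℝ) (s : EuclideanSpace ℝ (Fin p))
    (y : EuclideanSpace ℝ (Fin q)) : Prop :=
  ∀ (X' : Matrix (Fin m) (Fin n) ℝ) (s' : EuclideanSpace ℝ (Fin p))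
    (y' : EuclideanSpace ℝ (Fin q)), vecNorm Q.γ y'.ofLp ≤ Q.ρ →
    Q.augLag lam θ₁ θ₂ X s y ≤ Q.augLag lam θ₁ θ₂ X' s' y' + eps

/-- Inner stopping condition (b): a small partial subgradient in `(X, s)`, approximate
optimality in `y`, and the bound `μ₁ ‖σ(X)‖_α ≤ η_k`. -/
def StopB (lam tau xi etak : ℝ) (θ₁ : EuclideanSpace ℝ (Fin q))
    (θ₂ : EuclideanSpace ℝ (Fin p)) (X : Matrix (Fin m) (Fin n) ℝ)
    (s : EuclideanSpace ℝ (Fin p)) (y : EuclideanSpace ℝ (Fin q)) : Prop :=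
  (∃ (G : Matrix (Fin m) (Fin n) ℝ) (g : EuclideanSpace ℝ (Fin p)),
      Q.IsPartialSubgradient lam θ₁ θ₂ X s y G g ∧
      Real.sqrt (frobNorm G ^ 2 + ‖g‖ ^ 2) ≤ tau) ∧
  Q.ρ * dualVecNorm Q.γ (Q.gradY lam θ₁ θ₂ X s y)
      + inner ℝ (Q.gradY lam θ₁ θ₂ X s y) y ≤ xi ∧
  Q.μ₁ * sigmaNorm Q.α X ≤ etak

/-- `(X^(k), s^(k), y^(k))`, with multipliers `θ₁^(k), θ₂^(k)`, is a run of the first-order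
augmented Lagrangian algorithm with parameters `(λ^(k), ε^(k), τ^(k), ξ^(k))`, `k ≥ 1`, started
at `(X^(0), s^(0), y^(0))`. The `k`-th inner solver may return any point with `‖y‖_γ ≤ ρ` that
passes one of the two stopping conditions; here
`η_k = μ₁ ‖σ(X^(0))‖_α + μ₂ ‖C(X^(0)) - d‖_β + (λ^(k)/2) (‖θ₁^(k)‖₂² + ‖θ₂^(k)‖₂²)`. -/
structure IsRun (lam eps tau xi : ℕ → ℝ) (X : ℕ → Matrix (Fin m) (Fin n) ℝ)
    (s : ℕ → EuclideanSpace ℝ (Fin p)) (y : ℕ → EuclideanSpace ℝ (Fin q))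
    (θ₁ : ℕ → EuclideanSpace ℝ (Fin q)) (θ₂ : ℕ → EuclideanSpace ℝ (Fin p)) : Prop where
  init₁ : θ₁ 1 = 0
  init₂ : θ₂ 1 = 0
  mem_ball : ∀ k, 1 ≤ k → vecNorm Q.γ (y k).ofLp ≤ Q.ρ
  inner_done : ∀ k, 1 ≤ k →
    Q.StopA (lam k) (eps k) (θ₁ k) (θ₂ k) (X k) (s k) (y k) ∨
    Q.StopB (lam k) (tau k) (xi k)
      (Q.objective (X 0) + lam k / 2 * (‖θ₁ k‖ ^ 2 + ‖θ₂ k‖ ^ 2))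
      (θ₁ k) (θ₂ k) (X k) (s k) (y k)
  update₁ : ∀ k, 1 ≤ k → θ₁ (k + 1) = θ₁ k - (lam k)⁻¹ • (Q.A (X k) + y k - Q.b)
  update₂ : ∀ k, 1 ≤ k → θ₂ (k + 1) = θ₂ k - (lam k)⁻¹ • (Q.C (X k) + s k - Q.d)

end Problem

/-- `u^(k) ↘ 0` for `k ≥ 1`: the sequence decreases monotonically to `0`. -/
def DecreasesToZero (u : ℕ → ℝ) : Prop :=
  AntitoneOn u (Set.Ici 1) ∧ Tendsto u atTop (𝓝 0)

/-- The conditions on the parameter sequences `(λ^(k), ε^(k), τ^(k), ξ^(k))`, `k ≥ 1`. -/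
structure ParamConditions (lam eps tau xi : ℕ → ℝ) : Prop where
  lam_pos : ∀ k, 1 ≤ k → 0 < lam k
  lam_decr : DecreasesToZero lam
  eps_decr : DecreasesToZero eps
  eps_bound : ∃ B : ℝ, 0 < B ∧ ∀ k, 1 ≤ k → eps k / lam k ^ 2 ≤ B
  tau_decr : DecreasesToZero tau
  xi_decr : DecreasesToZero xi
  tau_ratio : Tendsto (fun k => tau k / lam k) atTop (𝓝 0)
  xi_ratio : Tendsto (fun k => xi k / lam k) atTop (𝓝 0)

end FALC

end

/-! Write `f` for the penalty `μ₁ ‖σ(X)‖_α + μ₂ ‖s‖_β`. Either stopping rule makes an iterate nearly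
optimal for the subproblem, up to `τ` times the step length plus `ε`. Test this against a step `λ(D,
h)`: the penalty term grows by at most `λ² f(D, h)`, and the linear term of the smooth part is `-λ²`
times the pairing of the new multipliers with `(A D, C D + h)`. Dividing by `λ²`, and using that
`(D, h) ↦ (A D, C D + h)` is onto because `A` is, bounds the multipliers
(`exists_multiplier_bound`).

The residuals equal `λ^(k) (θ^(k) - θ^(k+1))`, hence are `O(λ)`, so the iterates are asymptotically
feasible. Comparing an iterate with the zero-residual point over `X_*` and dividing by `λ`
(`mul_penalty_le`) bounds its optimality gap by `(τ/λ) K ‖X^(k) - X_*‖ + o(1)`.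

This bound may grow with the distance, and no boundedness of the iterates is known. Convexity
replaces it (`tendsto_of_unique_minimizer`): an iterate far from `X_*` is pulled back along a
segment to a small sphere, where uniqueness forces a definite violation of feasibility or
optimality. -/

/-- Approximate minimizers of a convex function over a convex sublevel set converge to the
minimizer, if the latter is unique; the optimality gap may grow with the distance. -/
theorem tendsto_of_unique_minimizer {E : Type*} [NormedAddCommGroup E] [NormedSpace ℝ E]
    [FiniteDimensional ℝ E] {F g : E → ℝ} (hF : ConvexOn ℝ Set.univ F)
    (hg : ConvexOn ℝ Set.univ g) (hFc : Continuous F) (hgc : Continuous g) {ρ : ℝ} {x₀ : E}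
    (hx₀ : g x₀ ≤ ρ) (huniq : ∀ x, g x ≤ ρ → F x ≤ F x₀ → x = x₀) {x : ℕ → E}
    {a e₁ e₂ : ℕ → ℝ} (ha : Tendsto a atTop (𝓝 0)) (he₁ : Tendsto e₁ atTop (𝓝 0))
    (he₂ : Tendsto e₂ atTop (𝓝 0)) (hgx : ∀ᶠ k in atTop, g (x k) ≤ ρ + e₁ k)
    (hFx : ∀ᶠ k in atTop, F (x k) ≤ F x₀ + a k * ‖x k - x₀‖ + e₂ k) :
    Tendsto x atTop (𝓝 x₀) := by
  have : ProperSpace E := FiniteDimensional.proper ℝ E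
  rw [Metric.tendsto_nhds]
  intro δ hδ
  -- By uniqueness, each point of the sphere is infeasible or has a larger value; compactness makes
  -- the violation uniform. The sphere is empty when `E` is trivial, and then any `c` works.
  obtain ⟨c, hc, hcS⟩ : ∃ c > 0, ∀ w, ‖w - x₀‖ = δ → c ≤ max (g w - ρ) (F w - F x₀) := by
    rcases (Metric.sphere x₀ δ).eq_empty_or_nonempty with hS | hS
    · exact ⟨1, one_pos, fun w hw => by
        have : w ∈ Metric.sphere x₀ δ := by simpa [dist_eq_norm] using hw
        simp [hS] at this⟩
    · obtain ⟨v, hv, hmin⟩ := (isCompact_sphere x₀ δ).exists_isMinOn hS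
        (f := fun w => max (g w - ρ) (F w - F x₀)) (by fun_prop)
      refine ⟨_, ?_, fun w hw => hmin (by simpa [dist_eq_norm] using hw)⟩
      by_contra! h
      have h1 := (le_max_left _ _).trans h
      have h2 := (le_max_right _ _).trans h
      have := huniq v (by linarith) (by linarith)
      rw [this] at hv
      simp at hv
      linarith
  have h₁ : ∀ᶠ k in atTop, |e₁ k| < c := by
    simpa using (he₁.abs).eventually (gt_mem_nhds (by simpa using hc))
  have h₂ : ∀ᶠ k in atTop, |a k| * δ + |e₂ k| < c := by
    have := ((ha.abs.mul_const δ).add he₂.abs)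
    simp only [abs_zero, zero_mul, add_zero] at this
    exact this.eventually (gt_mem_nhds hc)
  filter_upwards [h₁, h₂, hgx, hFx] with k h₁ h₂ hg' hF'
  rw [dist_eq_norm]
  by_contra! hk
  have hpos : 0 < ‖x k - x₀‖ := hδ.trans_le hk
  -- The segment from `x₀` to `x k` meets the sphere at parameter `r`. The factor `r` turns the
  -- error `a k * ‖x k - x₀‖` into `a k * δ`, which tends to zero however far away `x k` is.
  set r := δ / ‖x k - x₀‖ with hr
  have hr0 : 0 ≤ r := by positivity
  have hr1 : r ≤ 1 := (div_le_one hpos).2 hk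
  have hrn : r * ‖x k - x₀‖ = δ := by rw [hr]; field_simp
  have hw : ‖((1 - r) • x₀ + r • x k) - x₀‖ = δ := by
    rw [show ((1 - r) • x₀ + r • x k) - x₀ = r • (x k - x₀) by module, norm_smul,
      Real.norm_of_nonneg hr0, hrn]
  have hgw := hg.2 (Set.mem_univ x₀) (Set.mem_univ (x k)) (sub_nonneg.2 hr1) hr0 (by ring)
  have hFw := hF.2 (Set.mem_univ x₀) (Set.mem_univ (x k)) (sub_nonneg.2 hr1) hr0 (by ring)
  have hmax := hcS _ hw
  simp only [smul_eq_mul] at hgw hFw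
  have b₁ : r * e₁ k ≤ |e₁ k| := by
    nlinarith [le_abs_self (e₁ k), abs_nonneg (e₁ k)]
  have b₂ : r * e₂ k ≤ |e₂ k| := by
    nlinarith [le_abs_self (e₂ k), abs_nonneg (e₂ k)]
  have b₃ : a k * δ ≤ |a k| * δ := by gcongr; exact le_abs_self _
  have b₄ : r * (a k * ‖x k - x₀‖) = a k * δ := by rw [← hrn]; ring
  rcases le_max_iff.1 hmax with h | h
  · nlinarith [mul_le_mul_of_nonneg_left hg' hr0, mul_le_mul_of_nonneg_left hx₀ (sub_nonneg.2 hr1)]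
  · nlinarith [mul_le_mul_of_nonneg_left hF' hr0]

/-! ### Singular values: variational bounds and the triangle inequality -/

noncomputable section

namespace LinearMap

variable {E F : Type*} [NormedAddCommGroup E] [InnerProductSpace ℝ E] [FiniteDimensional ℝ E]
  [NormedAddCommGroup F] [InnerProductSpace ℝ F] [FiniteDimensional ℝ F] {n : ℕ}

/-- An orthonormal basis of right singular vectors of a linear map. -/
def rightSingularBasis (T : E →ₗ[ℝ] F) (hn : Module.finrank ℝ E = n) :
    OrthonormalBasis (Fin n) ℝ E :=
  T.isSymmetric_adjoint_comp_self.eigenvectorBasis hn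

theorem inner_map_rightSingularBasis (T : E →ₗ[ℝ] F) (hn : Module.finrank ℝ E = n)
    (i j : Fin n) :
    inner ℝ (T (T.rightSingularBasis hn i)) (T (T.rightSingularBasis hn j)) =
      if i = j then T.singularValues i ^ 2 else 0 := by
  rw [← LinearMap.adjoint_inner_right, ← LinearMap.comp_apply]
  have h := T.isSymmetric_adjoint_comp_self.apply_eigenvectorBasis hn j
  change (adjoint T ∘ₗ T) (T.rightSingularBasis hn j) = _ at h
  rw [h, ← sq_singularValues_fin]
  change inner ℝ _ ((T.singularValues j ^ 2 : ℝ) • T.rightSingularBasis hn j) = _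
  rw [inner_smul_right, orthonormal_iff_ite.1 (T.rightSingularBasis hn).orthonormal]
  split_ifs with hij <;> simp [hij]

theorem norm_map_rightSingularBasis (T : E →ₗ[ℝ] F) (hn : Module.finrank ℝ E = n) (i : Fin n) :
    ‖T (T.rightSingularBasis hn i)‖ = T.singularValues i := by
  have h := T.inner_map_rightSingularBasis hn i i
  rw [real_inner_self_eq_norm_sq, if_pos rfl] at h
  exact (sq_eq_sq₀ (norm_nonneg _) (T.singularValues_nonneg _)).1 h

/-- Bessel's inequality for the normalized images of the right singular vectors. -/
theorem sum_inner_sq_le (T : E →ₗ[ℝ] F) (hn : Module.finrank ℝ E = n) (z : F) :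
    ∑ i : Fin n, inner ℝ z ((T.singularValues i)⁻¹ • T (T.rightSingularBasis hn i)) ^ 2 ≤ ‖z‖ ^ 2 := by
  classical
  let w : Fin n → F := fun i => (T.singularValues i)⁻¹ • T (T.rightSingularBasis hn i)
  -- For a zero singular value the convention `0⁻¹ = 0` gives `w i = 0`, so orthonormality is
  -- claimed on the other indices only and the rest add nothing to the sum.
  have hw : Orthonormal ℝ (fun i : {i : Fin n // T.singularValues i ≠ 0} => w i) := by
    rw [orthonormal_iff_ite]
    intro i j
    simp only [w, inner_smul_left, inner_smul_right, inner_map_rightSingularBasis]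
    by_cases hij : i = j
    · subst hij
      have := i.2
      simp
      field_simp
    · have : (i : Fin n) ≠ j := fun h => hij (Subtype.ext h)
      simp [hij, this]
  have hb := hw.sum_inner_products_le z (s := Finset.univ)
  refine le_trans (le_of_eq ?_) hb
  rw [← Finset.sum_subtype ({i : Fin n | T.singularValues i ≠ 0} : Finset (Fin n))
    (p := fun i : Fin n => T.singularValues i ≠ 0) (by simp) (fun i => ‖inner ℝ (w i) z‖ ^ 2)]
  rw [Finset.sum_filter]
  refine Finset.sum_congr rfl fun i _ => ?_
  split_ifs with hi
  · rw [real_inner_comm, Real.norm_eq_abs, sq_abs]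
  · simp at hi; simp [hi]

/-- The pairing of `S` with the polar part of `T` is at most the sum of the norms of the images
of an orthonormal basis under `S`. -/
theorem sum_inner_polar_le (T S : E →ₗ[ℝ] F) (hn : Module.finrank ℝ E = n)
    (v : OrthonormalBasis (Fin n) ℝ E) :
    ∑ i, inner ℝ (S (T.rightSingularBasis hn i))
      ((T.singularValues i)⁻¹ • T (T.rightSingularBasis hn i)) ≤ ∑ j, ‖S (v j)‖ := by
  set u := T.rightSingularBasis hn
  set w : Fin n → F := fun i => (T.singularValues i)⁻¹ • T (u i)
  -- Expand `u i` in the basis `v` and exchange the sums. For each `j`, Cauchy–Schwarz then pairs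
  -- the coordinates of the unit vector `v j` with those of `S (v j)` along `w`, which Bessel
  -- controls.
  have h1 : ∀ i, inner ℝ (S (u i)) (w i) = ∑ j, inner ℝ (v j) (u i) * inner ℝ (S (v j)) (w i) := by
    intro i
    conv_lhs => rw [← v.sum_repr' (u i)]
    simp [map_sum, sum_inner, inner_smul_left]
  change ∑ i, inner ℝ (S (u i)) (w i) ≤ _
  simp_rw [h1]
  rw [Finset.sum_comm]
  refine Finset.sum_le_sum fun j _ => ?_
  refine (Real.sum_mul_le_sqrt_mul_sqrt _ _ _).trans ?_
  have h2 : ∑ i, inner ℝ (v j) (u i) ^ 2 = 1 := by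
    have := u.sum_sq_norm_inner_left (v j)
    simp only [Real.norm_eq_abs, sq_abs] at this
    rw [this]; simp
  rw [h2, Real.sqrt_one, one_mul]
  exact Real.sqrt_le_iff.2 ⟨norm_nonneg _, T.sum_inner_sq_le hn _⟩

theorem sum_inner_polar_self (T : E →ₗ[ℝ] F) (hn : Module.finrank ℝ E = n) :
    ∑ i, inner ℝ (T (T.rightSingularBasis hn i))
      ((T.singularValues i)⁻¹ • T (T.rightSingularBasis hn i)) =
      ∑ i : Fin n, T.singularValues i := by
  refine Finset.sum_congr rfl fun i _ => ?_
  rw [inner_smul_right, inner_map_rightSingularBasis, if_pos rfl]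
  by_cases h : T.singularValues i = 0
  · simp [h]
  · field_simp

theorem sum_singularValues_le (T : E →ₗ[ℝ] F) (hn : Module.finrank ℝ E = n)
    (v : OrthonormalBasis (Fin n) ℝ E) :
    ∑ i : Fin n, T.singularValues i ≤ ∑ j, ‖T (v j)‖ := by
  rw [← T.sum_inner_polar_self hn]
  exact T.sum_inner_polar_le T hn v

/-- Pairing with the polar part of `T + S` is linear, gives the left side on `T + S`, and on `T` and
`S` is bounded using their own right singular bases. -/
theorem sum_singularValues_add_le (T S : E →ₗ[ℝ] F) (hn : Module.finrank ℝ E = n) :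
    ∑ i : Fin n, (T + S).singularValues i ≤
      ∑ i : Fin n, T.singularValues i + ∑ i : Fin n, S.singularValues i := by
  rw [← (T + S).sum_inner_polar_self hn]
  conv_lhs => enter [2, i]; rw [add_apply, inner_add_left]
  rw [Finset.sum_add_distrib]
  refine add_le_add (((T + S).sum_inner_polar_le T hn (T.rightSingularBasis hn)).trans ?_)
    (((T + S).sum_inner_polar_le S hn (S.rightSingularBasis hn)).trans ?_) <;>
  simp [norm_map_rightSingularBasis]

/-- Both sides are the trace of `adjoint T ∘ₗ T`, which does not depend on the basis. -/
theorem sum_sq_singularValues (T : E →ₗ[ℝ] F) (hn : Module.finrank ℝ E = n)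
    (v : OrthonormalBasis (Fin n) ℝ E) :
    ∑ i : Fin n, T.singularValues i ^ 2 = ∑ j, ‖T (v j)‖ ^ 2 := by
  have h : ∀ u : OrthonormalBasis (Fin n) ℝ E,
      ∑ j, ‖T (u j)‖ ^ 2 = LinearMap.trace ℝ E (adjoint T ∘ₗ T) := fun u => by
    rw [LinearMap.trace_eq_sum_inner _ u]
    refine Finset.sum_congr rfl fun j _ => ?_
    rw [LinearMap.comp_apply, LinearMap.adjoint_inner_right, real_inner_self_eq_norm_sq]
  rw [h v, ← h (T.rightSingularBasis hn)]
  simp [norm_map_rightSingularBasis]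

theorem norm_apply_le_of_singularValues_le (T : E →ₗ[ℝ] F) {K : ℝ} (hK : 0 ≤ K)
    (h : ∀ i, T.singularValues i ≤ K) (x : E) : ‖T x‖ ≤ K * ‖x‖ := by
  set u := T.rightSingularBasis rfl
  refine le_of_sq_le_sq ?_ (by positivity)
  have h1 : ‖T x‖ ^ 2 = ∑ i, inner ℝ (u i) x ^ 2 * T.singularValues i ^ 2 := by
    conv_lhs => rw [← u.sum_repr' x]
    rw [map_sum, ← real_inner_self_eq_norm_sq, sum_inner]
    refine Finset.sum_congr rfl fun i _ => ?_
    rw [inner_sum, Finset.sum_eq_single i]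
    · rw [map_smul, inner_smul_left, inner_smul_right, inner_map_rightSingularBasis, if_pos rfl]
      simp; ring
    · intro j _ hj
      rw [map_smul, map_smul, inner_smul_left, inner_smul_right, inner_map_rightSingularBasis,
        if_neg (Ne.symm hj)]
      simp
    · simp
  have h2 : ‖x‖ ^ 2 = ∑ i, inner ℝ (u i) x ^ 2 := by
    have := u.sum_sq_norm_inner_right x
    simp only [Real.norm_eq_abs, sq_abs] at this
    exact this.symm
  rw [h1, mul_pow, h2, Finset.mul_sum]
  refine Finset.sum_le_sum fun i _ => ?_
  rw [mul_comm]
  gcongr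
  · exact T.singularValues_nonneg _
  · exact h _

end LinearMap

/-! ### The vector, spectral and Frobenius norms as seminorms -/

namespace FALC

theorem fact_one_le {r : ℝ≥0∞} (hr : r = 1 ∨ r = 2 ∨ r = ∞) : Fact (1 ≤ r) := by
  rcases hr with rfl | rfl | rfl <;> exact ⟨by norm_num⟩

/-- The `ℓ_r` norm as a seminorm. -/
def vecSeminorm (l : ℕ) {r : ℝ≥0∞} (hr : r = 1 ∨ r = 2 ∨ r = ∞) :
    Seminorm ℝ (EuclideanSpace ℝ (Fin l)) :=
  haveI := fact_one_le hr
  (normSeminorm ℝ (PiLp r (fun _ : Fin l => ℝ))).comp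
    ((WithLp.linearEquiv r ℝ (Fin l → ℝ)).symm.toLinearMap ∘ₗ
      (WithLp.linearEquiv 2 ℝ (Fin l → ℝ)).toLinearMap)

theorem vecSeminorm_apply {l : ℕ} {r : ℝ≥0∞} (hr : r = 1 ∨ r = 2 ∨ r = ∞)
    (x : EuclideanSpace ℝ (Fin l)) : vecSeminorm l hr x = vecNorm r x.ofLp := rfl

section SigmaNorm

variable {m n : ℕ}

/-- The rank is at most `min m n`. This lets sums over `Fin (min m n)` be taken over `Fin n`, the
index set of a basis of the domain. -/
theorem singularValues_eq_zero_of_min_le (X : Matrix (Fin m) (Fin n) ℝ) {i : ℕ}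
    (hi : min m n ≤ i) : (Matrix.toEuclideanLin X).singularValues i = 0 := by
  rw [LinearMap.singularValues_eq_zero_iff_le_finrank_range]
  refine le_trans (le_min ?_ ?_) hi
  · simpa using Submodule.finrank_le (LinearMap.range (Matrix.toEuclideanLin X))
  · simpa using LinearMap.finrank_range_le (Matrix.toEuclideanLin X)

theorem sum_fin_min_eq {f : ℕ → ℝ} (hf : ∀ i, min m n ≤ i → f i = 0) :
    ∑ i : Fin (min m n), f i = ∑ i : Fin n, f i := by
  rw [Fin.sum_univ_eq_sum_range, Fin.sum_univ_eq_sum_range]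
  refine Finset.sum_subset (Finset.range_mono (min_le_right _ _)) fun i _ hi => hf i ?_
  exact not_lt.1 (Finset.mem_range.not.1 hi)

theorem sigmaNorm_one (X : Matrix (Fin m) (Fin n) ℝ) :
    sigmaNorm 1 X = ∑ i : Fin n, (Matrix.toEuclideanLin X).singularValues i := by
  rw [← sum_fin_min_eq (m := m) fun i => singularValues_eq_zero_of_min_le X, sigmaNorm, vecNorm,
    PiLp.norm_eq_of_L1]
  simp [singVals, abs_of_nonneg, LinearMap.singularValues_nonneg]

theorem sigmaNorm_two (X : Matrix (Fin m) (Fin n) ℝ)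
    (v : OrthonormalBasis (Fin n) ℝ (EuclideanSpace ℝ (Fin n))) :
    sigmaNorm 2 X = ‖WithLp.toLp 2 fun j => ‖Matrix.toEuclideanLin X (v j)‖‖ := by
  rw [sigmaNorm, vecNorm, EuclideanSpace.norm_eq, EuclideanSpace.norm_eq]
  congr 1
  simp only [← LinearMap.sum_sq_singularValues _ (by simp) v, Real.norm_eq_abs, sq_abs,
    singVals]
  exact sum_fin_min_eq (m := m) (f := fun i => (Matrix.toEuclideanLin X).singularValues i ^ 2)
    fun i hi => by simp [singularValues_eq_zero_of_min_le X hi]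

theorem singularValues_le_sigmaNorm_top (X : Matrix (Fin m) (Fin n) ℝ) (i : ℕ) :
    (Matrix.toEuclideanLin X).singularValues i ≤ sigmaNorm ∞ X := by
  by_cases hi : min m n ≤ i
  · rw [singularValues_eq_zero_of_min_le X hi]
    exact norm_nonneg _
  · have := PiLp.norm_apply_le (WithLp.toLp ∞ (singVals X)) ⟨i, not_le.1 hi⟩
    exact (le_abs_self _).trans this

theorem norm_apply_le_sigmaNorm_top (X : Matrix (Fin m) (Fin n) ℝ)
    (x : EuclideanSpace ℝ (Fin n)) :
    ‖Matrix.toEuclideanLin X x‖ ≤ sigmaNorm ∞ X * ‖x‖ :=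
  LinearMap.norm_apply_le_of_singularValues_le _ (norm_nonneg _)
    (singularValues_le_sigmaNorm_top X) x

theorem sigmaNorm_top_le (X : Matrix (Fin m) (Fin n) ℝ) {K : ℝ} (hK : 0 ≤ K)
    (h : ∀ x, ‖Matrix.toEuclideanLin X x‖ ≤ K * ‖x‖) : sigmaNorm ∞ X ≤ K := by
  rw [sigmaNorm, vecNorm, PiLp.norm_toLp, pi_norm_le_iff_of_nonneg hK]
  intro i
  have hi : (i : ℕ) < n := i.2.trans_le (min_le_right _ _)
  have := h ((Matrix.toEuclideanLin X).rightSingularBasis (by simp) ⟨i, hi⟩)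
  rw [LinearMap.norm_map_rightSingularBasis, OrthonormalBasis.norm_eq_one, mul_one] at this
  rwa [singVals, Real.norm_of_nonneg (LinearMap.singularValues_nonneg _ _)]

theorem sigmaNorm_zero {r : ℝ≥0∞} (hr : r = 1 ∨ r = 2 ∨ r = ∞) :
    sigmaNorm r (0 : Matrix (Fin m) (Fin n) ℝ) = 0 := by
  have := fact_one_le hr
  have h : singVals (0 : Matrix (Fin m) (Fin n) ℝ) = 0 := by
    ext i; simp [singVals]
  rw [sigmaNorm, h, vecNorm, WithLp.toLp_zero, norm_zero]

theorem sigmaNorm_add_le {r : ℝ≥0∞} (hr : r = 1 ∨ r = 2 ∨ r = ∞)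
    (X Y : Matrix (Fin m) (Fin n) ℝ) : sigmaNorm r (X + Y) ≤ sigmaNorm r X + sigmaNorm r Y := by
  rcases hr with rfl | rfl | rfl
  · simp only [sigmaNorm_one, map_add]
    exact LinearMap.sum_singularValues_add_le _ _ (by simp)
  · let v := EuclideanSpace.basisFun (Fin n) ℝ
    rw [sigmaNorm_two _ v, sigmaNorm_two _ v, sigmaNorm_two _ v]
    refine le_trans ?_ (norm_add_le _ _)
    rw [EuclideanSpace.norm_eq, EuclideanSpace.norm_eq]
    refine Real.sqrt_le_sqrt (Finset.sum_le_sum fun j _ => ?_)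
    simp only [norm_norm, PiLp.add_apply, map_add, LinearMap.add_apply]
    rw [Real.norm_of_nonneg (by positivity)]
    gcongr
    exact norm_add_le _ _
  · refine sigmaNorm_top_le _ (add_nonneg (norm_nonneg _) (norm_nonneg _)) fun x => ?_
    rw [map_add, LinearMap.add_apply, add_mul]
    exact (norm_add_le _ _).trans
      (add_le_add (norm_apply_le_sigmaNorm_top X x) (norm_apply_le_sigmaNorm_top Y x))

theorem sigmaNorm_smul_le {r : ℝ≥0∞} (hr : r = 1 ∨ r = 2 ∨ r = ∞) (c : ℝ)
    (X : Matrix (Fin m) (Fin n) ℝ) : sigmaNorm r (c • X) ≤ ‖c‖ * sigmaNorm r X := by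
  rcases hr with rfl | rfl | rfl
  · rw [sigmaNorm_one, sigmaNorm_one]
    refine (LinearMap.sum_singularValues_le _ (by simp)
      ((Matrix.toEuclideanLin X).rightSingularBasis (by simp))).trans (le_of_eq ?_)
    simp [map_smul, norm_smul, LinearMap.norm_map_rightSingularBasis, Finset.mul_sum]
  · let v := EuclideanSpace.basisFun (Fin n) ℝ
    rw [sigmaNorm_two _ v, sigmaNorm_two _ v, ← norm_norm c, ← norm_smul]
    refine le_of_eq (congrArg _ ?_)
    ext j
    simp [norm_smul]
  · refine sigmaNorm_top_le _ (mul_nonneg (norm_nonneg _) (norm_nonneg _)) fun x => ?_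
    rw [map_smul, LinearMap.smul_apply, norm_smul, mul_assoc]
    gcongr
    exact norm_apply_le_sigmaNorm_top X x

/-- The norm `‖σ(X)‖_r` as a seminorm. -/
def sigmaSeminorm (m n : ℕ) {r : ℝ≥0∞} (hr : r = 1 ∨ r = 2 ∨ r = ∞) :
    Seminorm ℝ (Matrix (Fin m) (Fin n) ℝ) :=
  Seminorm.ofSMulLE (sigmaNorm r) (sigmaNorm_zero hr) (sigmaNorm_add_le hr) (sigmaNorm_smul_le hr)

end SigmaNorm

section Frobenius
open scoped Matrix.Norms.Frobenius

variable {m n : ℕ}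

/-- The Frobenius norm as a seminorm. -/
def frobSeminorm (m n : ℕ) : Seminorm ℝ (Matrix (Fin m) (Fin n) ℝ) :=
  normSeminorm ℝ (Matrix (Fin m) (Fin n) ℝ)

theorem frobSeminorm_apply (X : Matrix (Fin m) (Fin n) ℝ) : frobSeminorm m n X = frobNorm X := rfl

theorem frobNorm_eq_sqrt (X : Matrix (Fin m) (Fin n) ℝ) :
    frobNorm X = √(∑ i, ∑ j, X i j ^ 2) := by
  rw [frobNorm, Matrix.frobenius_norm_def, ← Real.sqrt_eq_rpow]
  simp

end Frobenius

theorem abs_matInner_le {m n : ℕ} (X Y : Matrix (Fin m) (Fin n) ℝ) :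
    |matInner X Y| ≤ frobNorm X * frobNorm Y := by
  have h : matInner X Y = ∑ x : Fin m × Fin n, X x.1 x.2 * Y x.1 x.2 := by
    rw [matInner, Matrix.trace, Fintype.sum_prod_type, Finset.sum_comm]
    simp [Matrix.mul_apply]
  have hs : ∀ Z : Matrix (Fin m) (Fin n) ℝ,
      frobNorm Z = √(∑ x : Fin m × Fin n, Z x.1 x.2 ^ 2) := fun Z => by
    rw [frobNorm_eq_sqrt, Fintype.sum_prod_type]
  rw [h, hs, hs, abs_le]
  refine ⟨?_, Real.sum_mul_le_sqrt_mul_sqrt _ _ _⟩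
  have := Real.sum_mul_le_sqrt_mul_sqrt Finset.univ (fun x : Fin m × Fin n => - X x.1 x.2)
    (fun x => Y x.1 x.2)
  simp only [neg_mul, Finset.sum_neg_distrib, neg_sq] at this
  linarith

end FALC

/-! ### Finite-dimensional seminorms, duality and a limiting argument -/

theorem Seminorm.continuous_of_finiteDimensional_real {E : Type*} [NormedAddCommGroup E]
    [NormedSpace ℝ E] [FiniteDimensional ℝ E] (p : Seminorm ℝ E) : Continuous p :=
  continuousOn_univ.1 (p.convexOn.continuousOn isOpen_univ)

theorem Seminorm.exists_bound_of_finiteDimensional {E : Type*} [NormedAddCommGroup E]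
    [NormedSpace ℝ E] [FiniteDimensional ℝ E] (p : Seminorm ℝ E) :
    ∃ K, 0 ≤ K ∧ ∀ x, p x ≤ K * ‖x‖ := by
  obtain ⟨K, hK, h⟩ := p.bound_of_continuous_normedSpace p.continuous_of_finiteDimensional_real
  exact ⟨K, hK.le, h⟩

theorem norm_le_of_forall_inner_le {V : Type*} [NormedAddCommGroup V] [InnerProductSpace ℝ V]
    {θ : V} {M : ℝ} (hM : 0 ≤ M) (h : ∀ u : V, ‖u‖ ≤ 1 → inner ℝ θ u ≤ M) : ‖θ‖ ≤ M := by
  by_cases hθ : ‖θ‖ = 0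
  · rwa [hθ]
  · have := h (‖θ‖⁻¹ • θ) (by rw [norm_smul, norm_inv, norm_norm, inv_mul_cancel₀ hθ])
    rw [inner_smul_right, real_inner_self_eq_norm_sq, sq, inv_mul_cancel_left₀ hθ] at this
    exact this

theorem nonneg_of_forall_add_mul_nonneg {a c : ℝ} (h : ∀ t, 0 < t → t ≤ 1 → 0 ≤ a + t * c) :
    0 ≤ a := by
  have h1 : Tendsto (fun t : ℝ => a + t * c) (𝓝[>] 0) (𝓝 (a + 0 * c)) :=
    (Continuous.tendsto (by fun_prop) 0).mono_left nhdsWithin_le_nhds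
  rw [zero_mul, add_zero] at h1
  refine ge_of_tendsto h1 ?_
  filter_upwards [Ioo_mem_nhdsGT (zero_lt_one (α := ℝ))] with t ht
  exact h t ht.1 ht.2.le

namespace FALC

attribute [local instance] Matrix.normedAddCommGroup Matrix.normedSpace

theorem DecreasesToZero.nonneg {u : ℕ → ℝ} (h : DecreasesToZero u) {k : ℕ} (hk : 1 ≤ k) :
    0 ≤ u k :=
  le_of_tendsto h.2 <| (eventually_ge_atTop k).mono fun _ hj =>
    h.1 hk (hk.trans hj : 1 ≤ _) hj

/-- The Hölder inequality for the dual norm, on a ball of radius `ρ`. -/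
theorem neg_inner_le_mul_dualVecNorm {l : ℕ} {r : ℝ≥0∞} (hr : r = 1 ∨ r = 2 ∨ r = ∞) {ρ : ℝ}
    (v y : EuclideanSpace ℝ (Fin l)) (hy : vecNorm r y.ofLp ≤ ρ) :
    -inner ℝ v y ≤ ρ * dualVecNorm r v := by
  have hfact := fact_one_le hr
  have hρ : 0 ≤ ρ := (norm_nonneg _).trans hy
  rcases hρ.eq_or_lt with rfl | hρ
  · have : y = 0 := by
      have h0 : (WithLp.toLp r y.ofLp : PiLp r (fun _ : Fin l => ℝ)) = 0 :=
        norm_le_zero_iff.1 hy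
      ext i
      exact congrFun (congrArg WithLp.ofLp h0) i
    simp [this]
  · let e : PiLp r (fun _ : Fin l => ℝ) →ₗ[ℝ] EuclideanSpace ℝ (Fin l) :=
      (WithLp.linearEquiv 2 ℝ (Fin l → ℝ)).symm.toLinearMap ∘ₗ
        (WithLp.linearEquiv r ℝ (Fin l → ℝ)).toLinearMap
    obtain ⟨K, hK, hKb⟩ := ((normSeminorm ℝ (EuclideanSpace ℝ (Fin l))).comp
      e).exists_bound_of_finiteDimensional
    have hbdd : BddAbove {t : ℝ | ∃ w : EuclideanSpace ℝ (Fin l),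
        vecNorm r w.ofLp ≤ 1 ∧ t = inner ℝ w v} := by
      refine ⟨K * ‖v‖, ?_⟩
      rintro _ ⟨w, hw, rfl⟩
      refine (real_inner_le_norm w v).trans ?_
      gcongr
      exact (hKb (WithLp.toLp r w.ofLp)).trans (mul_le_of_le_one_right hK hw)
    -- The test vector `-y/ρ` lies in the unit ball; the case `ρ = 0` was split off because then `y
    -- = 0`.
    have hle : inner ℝ (-ρ⁻¹ • y) v ≤ dualVecNorm r v := by
      refine le_csSup hbdd ⟨_, ?_, rfl⟩
      rw [← vecSeminorm_apply hr, map_smul_eq_mul, vecSeminorm_apply, norm_neg, norm_inv,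
        Real.norm_of_nonneg hρ.le, inv_mul_le_one₀ hρ]
      exact hy
    rw [inner_smul_left, real_inner_comm] at hle
    simp only [conj_trivial] at hle
    calc -inner ℝ v y = ρ * (-ρ⁻¹ * inner ℝ v y) := by field_simp
      _ ≤ _ := by gcongr

/-- The quantity `‖D‖_F + ‖h‖₂` as a seminorm. -/
def stepSeminorm (m n p : ℕ) :
    Seminorm ℝ (Matrix (Fin m) (Fin n) ℝ × EuclideanSpace ℝ (Fin p)) :=
  (frobSeminorm m n).comp (LinearMap.fst ℝ _ _) + (normSeminorm ℝ _).comp (LinearMap.snd ℝ _ _)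

theorem stepSeminorm_apply {m n p : ℕ} (D : Matrix (Fin m) (Fin n) ℝ)
    (h : EuclideanSpace ℝ (Fin p)) : stepSeminorm m n p (D, h) = frobNorm D + ‖h‖ := rfl

/-! ### Estimates for a single subproblem -/

namespace Problem

variable {m n p q : ℕ} (Q : Problem m n p q)

/-- The nonsmooth part `μ₁ ‖σ(X)‖_α + μ₂ ‖s‖_β` as a seminorm. -/
def penalty (hα : Q.α = 1 ∨ Q.α = 2 ∨ Q.α = ∞) (hβ : Q.β = 1 ∨ Q.β = 2 ∨ Q.β = ∞)
    (hμ₁ : 0 ≤ Q.μ₁) (hμ₂ : 0 ≤ Q.μ₂) :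
    Seminorm ℝ (Matrix (Fin m) (Fin n) ℝ × EuclideanSpace ℝ (Fin p)) :=
  let c₁ : NNReal := ⟨Q.μ₁, hμ₁⟩
  let c₂ : NNReal := ⟨Q.μ₂, hμ₂⟩
  c₁ • (sigmaSeminorm m n hα).comp
      (LinearMap.fst ℝ (Matrix (Fin m) (Fin n) ℝ) (EuclideanSpace ℝ (Fin p))) +
    c₂ • (vecSeminorm p hβ).comp
      (LinearMap.snd ℝ (Matrix (Fin m) (Fin n) ℝ) (EuclideanSpace ℝ (Fin p)))

variable {Q}

section

variable {hα : Q.α = 1 ∨ Q.α = 2 ∨ Q.α = ∞} {hβ : Q.β = 1 ∨ Q.β = 2 ∨ Q.β = ∞}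
  {hμ₁ : 0 ≤ Q.μ₁} {hμ₂ : 0 ≤ Q.μ₂}

theorem penalty_apply (X : Matrix (Fin m) (Fin n) ℝ) (s : EuclideanSpace ℝ (Fin p)) :
    Q.penalty hα hβ hμ₁ hμ₂ (X, s) = Q.μ₁ * sigmaNorm Q.α X + Q.μ₂ * vecNorm Q.β s.ofLp := rfl

theorem objective_eq_penalty (X : Matrix (Fin m) (Fin n) ℝ) :
    Q.objective X = Q.penalty hα hβ hμ₁ hμ₂ (X, Q.C X - Q.d) := rfl

theorem augLag_eq (lam : ℝ) (θ₁ : EuclideanSpace ℝ (Fin q)) (θ₂ : EuclideanSpace ℝ (Fin p))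
    (X : Matrix (Fin m) (Fin n) ℝ) (s : EuclideanSpace ℝ (Fin p))
    (y : EuclideanSpace ℝ (Fin q)) :
    Q.augLag lam θ₁ θ₂ X s y =
      lam * Q.penalty hα hβ hμ₁ hμ₂ (X, s) + Q.smoothPart lam θ₁ θ₂ X s y := rfl

end

section

variable {lam : ℝ} {θ₁ : EuclideanSpace ℝ (Fin q)} {θ₂ : EuclideanSpace ℝ (Fin p)}
  {X : Matrix (Fin m) (Fin n) ℝ} {s : EuclideanSpace ℝ (Fin p)} {y : EuclideanSpace ℝ (Fin q)}

theorem smoothPart_add (D : Matrix (Fin m) (Fin n) ℝ) (h : EuclideanSpace ℝ (Fin p)) :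
    Q.smoothPart lam θ₁ θ₂ (X + D) (s + h) y = Q.smoothPart lam θ₁ θ₂ X s y
      + (inner ℝ (Q.A X + y - Q.b - lam • θ₁) (Q.A D)
        + inner ℝ (Q.C X + s - Q.d - lam • θ₂) (Q.C D + h))
      + 1 / 2 * (‖Q.A D‖ ^ 2 + ‖Q.C D + h‖ ^ 2) := by
  rw [smoothPart, smoothPart, map_add, map_add,
    show Q.A X + Q.A D + y - Q.b - lam • θ₁ = (Q.A X + y - Q.b - lam • θ₁) + Q.A D by abel,
    show Q.C X + Q.C D + (s + h) - Q.d - lam • θ₂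
      = (Q.C X + s - Q.d - lam • θ₂) + (Q.C D + h) by abel,
    norm_add_sq_real, norm_add_sq_real]
  ring

theorem gradY_eq : Q.gradY lam θ₁ θ₂ X s y = Q.A X + y - Q.b - lam • θ₁ := by
  refine HasGradientAt.gradient ?_
  rw [hasGradientAt_iff_hasFDerivAt]
  have h1 : HasFDerivAt (fun y' : EuclideanSpace ℝ (Fin q) => Q.A X + y' - Q.b - lam • θ₁)
      (ContinuousLinearMap.id ℝ _) y :=
    (((hasFDerivAt_id y).const_add _).sub_const _).sub_const _
  have h2 := ((h1.norm_sq.const_mul (1 / 2)).add_const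
    (1 / 2 * ‖Q.C X + s - Q.d - lam • θ₂‖ ^ 2)).const_add
    (lam * (Q.μ₁ * sigmaNorm Q.α X + Q.μ₂ * vecNorm Q.β s.ofLp))
  refine h2.congr_fderiv ?_
  ext v
  simp

/-- Cauchy–Schwarz on the subgradient inequality; this form is shared with the other stopping rule.
-/
theorem IsPartialSubgradient.augLag_le {G : Matrix (Fin m) (Fin n) ℝ}
    {g : EuclideanSpace ℝ (Fin p)} {tau : ℝ} (hG : Q.IsPartialSubgradient lam θ₁ θ₂ X s y G g)
    (hle : √(frobNorm G ^ 2 + ‖g‖ ^ 2) ≤ tau) (D : Matrix (Fin m) (Fin n) ℝ)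
    (h : EuclideanSpace ℝ (Fin p)) :
    Q.augLag lam θ₁ θ₂ X s y ≤
      Q.augLag lam θ₁ θ₂ (X + D) (s + h) y + tau * stepSeminorm m n p (D, h) := by
  have h1 := hG (X + D) (s + h)
  simp only [add_sub_cancel_left] at h1
  have hGt : frobNorm G ≤ tau :=
    (Real.le_sqrt_of_sq_le (le_add_of_nonneg_right (sq_nonneg _))).trans hle
  have hgt : ‖g‖ ≤ tau :=
    (Real.le_sqrt_of_sq_le (le_add_of_nonneg_left (sq_nonneg _))).trans hle
  have h2 := (abs_le.1 (abs_matInner_le G D)).1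
  have h3 := (abs_le.1 (abs_real_inner_le_norm g h)).1
  have h4 : frobNorm G * frobNorm D ≤ tau * frobNorm D := by
    gcongr; exact apply_nonneg (frobSeminorm m n) D
  have h5 : ‖g‖ * ‖h‖ ≤ tau * ‖h‖ := by gcongr
  rw [stepSeminorm_apply, mul_add]
  linarith

variable {hα : Q.α = 1 ∨ Q.α = 2 ∨ Q.α = ∞} {hβ : Q.β = 1 ∨ Q.β = 2 ∨ Q.β = ∞}
  {hμ₁ : 0 ≤ Q.μ₁} {hμ₂ : 0 ≤ Q.μ₂}

/-- First-order optimality of the subproblem, from approximate optimality to first order. -/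
theorem mul_penalty_le_of_augLag_le (hlam : 0 ≤ lam) {tau : ℝ}
    (hP : ∀ (D : Matrix (Fin m) (Fin n) ℝ) (h : EuclideanSpace ℝ (Fin p)),
      Q.augLag lam θ₁ θ₂ X s y ≤
        Q.augLag lam θ₁ θ₂ (X + D) (s + h) y + tau * stepSeminorm m n p (D, h))
    (D : Matrix (Fin m) (Fin n) ℝ) (h : EuclideanSpace ℝ (Fin p)) :
    lam * Q.penalty hα hβ hμ₁ hμ₂ (X, s) ≤ lam * Q.penalty hα hβ hμ₁ hμ₂ (X + D, s + h)
      + (inner ℝ (Q.A X + y - Q.b - lam • θ₁) (Q.A D)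
        + inner ℝ (Q.C X + s - Q.d - lam • θ₂) (Q.C D + h))
      + tau * stepSeminorm m n p (D, h) := by
  set f := Q.penalty hα hβ hμ₁ hμ₂
  rw [← sub_nonneg]
  -- Take the step `t (D, h)`, divide by `t` and let `t → 0`: the quadratic term disappears.
  refine nonneg_of_forall_add_mul_nonneg (c := 1 / 2 * (‖Q.A D‖ ^ 2 + ‖Q.C D + h‖ ^ 2))
    fun t ht0 ht1 => ?_
  have h1 := hP (t • D) (t • h)
  rw [augLag_eq (hα := hα) (hβ := hβ) (hμ₁ := hμ₁) (hμ₂ := hμ₂),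
    augLag_eq (hα := hα) (hβ := hβ) (hμ₁ := hμ₁) (hμ₂ := hμ₂), smoothPart_add,
    ← Prod.smul_mk t D h, map_smul_eq_mul, Real.norm_of_nonneg ht0.le, map_smul, map_smul,
    ← smul_add, inner_smul_right, inner_smul_right, norm_smul, norm_smul, mul_pow, mul_pow,
    Real.norm_of_nonneg ht0.le] at h1
  have h2 := f.convexOn.2 (Set.mem_univ (X, s)) (Set.mem_univ (X + D, s + h))
    (sub_nonneg.2 ht1) ht0.le (by ring)
  rw [show (1 - t) • (X, s) + t • (X + D, s + h) = (X + t • D, s + t • h) by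
    ext1 <;> simp <;> module] at h2
  have h3 := mul_le_mul_of_nonneg_left h2 hlam
  simp only [smul_eq_mul] at h3
  refine nonneg_of_mul_nonneg_right (a := t) ?_ ht0
  change lam * f (X, s) + _ ≤ lam * f (X + t • D, s + t • h) + _ + _ at h1
  linarith

/-- The inner products of the updated multipliers with the images of a direction are bounded. -/
theorem inner_multiplier_le (hlam : 0 < lam) {e tau : ℝ}
    (hP : ∀ (D : Matrix (Fin m) (Fin n) ℝ) (h : EuclideanSpace ℝ (Fin p)),
      Q.augLag lam θ₁ θ₂ X s y ≤
        Q.augLag lam θ₁ θ₂ (X + D) (s + h) y + tau * stepSeminorm m n p (D, h) + e)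
    (D : Matrix (Fin m) (Fin n) ℝ) (h : EuclideanSpace ℝ (Fin p)) :
    inner ℝ (θ₁ - lam⁻¹ • (Q.A X + y - Q.b)) (Q.A D)
      + inner ℝ (θ₂ - lam⁻¹ • (Q.C X + s - Q.d)) (Q.C D + h) ≤
    Q.penalty hα hβ hμ₁ hμ₂ (D, h) + tau / lam * stepSeminorm m n p (D, h) + e / lam ^ 2
      + 1 / 2 * (‖Q.A D‖ ^ 2 + ‖Q.C D + h‖ ^ 2) := by
  set f := Q.penalty hα hβ hμ₁ hμ₂
  -- A step of size `λ` gives the penalty increment, the linear term and the quadratic term the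
  -- common factor `λ²`.
  have h1 := hP (lam • D) (lam • h)
  rw [augLag_eq (hα := hα) (hβ := hβ) (hμ₁ := hμ₁) (hμ₂ := hμ₂),
    augLag_eq (hα := hα) (hβ := hβ) (hμ₁ := hμ₁) (hμ₂ := hμ₂), smoothPart_add,
    ← Prod.smul_mk lam D h, map_smul_eq_mul, Real.norm_of_nonneg hlam.le, map_smul, map_smul,
    ← smul_add, inner_smul_right, inner_smul_right, norm_smul, norm_smul, mul_pow, mul_pow,
    Real.norm_of_nonneg hlam.le] at h1
  have h2 : f (X + lam • D, s + lam • h) ≤ f (X, s) + lam * f (D, h) := by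
    have := map_add_le_add f (X, s) (lam • (D, h))
    rwa [map_smul_eq_mul, Real.norm_of_nonneg hlam.le] at this
  have h3 := mul_le_mul_of_nonneg_left h2 hlam.le
  change lam * f (X, s) + _ ≤ lam * f (X + lam • D, s + lam • h) + _ + _ + _ at h1
  -- The shifted residual is `-λ` times the updated multiplier.
  have e1 : Q.A X + y - Q.b - lam • θ₁ = -lam • (θ₁ - lam⁻¹ • (Q.A X + y - Q.b)) := by
    rw [smul_sub, smul_smul, neg_mul, mul_inv_cancel₀ hlam.ne']; module
  have e2 : Q.C X + s - Q.d - lam • θ₂ = -lam • (θ₂ - lam⁻¹ • (Q.C X + s - Q.d)) := by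
    rw [smul_sub, smul_smul, neg_mul, mul_inv_cancel₀ hlam.ne']; module
  rw [e1, e2, inner_smul_left, inner_smul_left] at h1
  simp only [conj_trivial] at h1
  set i₁ := inner ℝ (θ₁ - lam⁻¹ • (Q.A X + y - Q.b)) (Q.A D)
  set i₂ := inner ℝ (θ₂ - lam⁻¹ • (Q.C X + s - Q.d)) (Q.C D + h)
  have h4 : lam ^ 2 * (i₁ + i₂) ≤ lam ^ 2 * (f (D, h) + tau / lam * stepSeminorm m n p (D, h)
      + e / lam ^ 2 + 1 / 2 * (‖Q.A D‖ ^ 2 + ‖Q.C D + h‖ ^ 2)) := by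
    have : lam ^ 2 * (f (D, h) + tau / lam * stepSeminorm m n p (D, h)
      + e / lam ^ 2 + 1 / 2 * (‖Q.A D‖ ^ 2 + ‖Q.C D + h‖ ^ 2)) =
      lam ^ 2 * f (D, h) + lam * tau * stepSeminorm m n p (D, h) + e
        + 1 / 2 * lam ^ 2 * (‖Q.A D‖ ^ 2 + ‖Q.C D + h‖ ^ 2) := by field_simp
    rw [this]
    linarith
  exact le_of_mul_le_mul_left h4 (by positivity)

end

/-! ### Runs: bounded multipliers and the optimality gap -/

section

variable {lam eps tau xi : ℕ → ℝ} {X : ℕ → Matrix (Fin m) (Fin n) ℝ}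
  {s : ℕ → EuclideanSpace ℝ (Fin p)} {y : ℕ → EuclideanSpace ℝ (Fin q)}
  {θ₁ : ℕ → EuclideanSpace ℝ (Fin q)} {θ₂ : ℕ → EuclideanSpace ℝ (Fin p)}

theorem IsRun.augLag_le (hparam : ParamConditions lam eps tau xi)
    (hrun : Q.IsRun lam eps tau xi X s y θ₁ θ₂) {k : ℕ} (hk : 1 ≤ k)
    (D : Matrix (Fin m) (Fin n) ℝ) (h : EuclideanSpace ℝ (Fin p)) :
    Q.augLag (lam k) (θ₁ k) (θ₂ k) (X k) (s k) (y k) ≤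
      Q.augLag (lam k) (θ₁ k) (θ₂ k) (X k + D) (s k + h) (y k)
        + tau k * stepSeminorm m n p (D, h) + eps k := by
  rcases hrun.inner_done k hk with ha | ⟨⟨G, g, hG, hle⟩, -, -⟩
  · have := ha (X k + D) (s k + h) (y k) (hrun.mem_ball k hk)
    have := mul_nonneg (hparam.tau_decr.nonneg hk) (apply_nonneg (stepSeminorm m n p) (D, h))
    linarith
  · have := hG.augLag_le hle D h
    have := hparam.eps_decr.nonneg hk
    linarith

theorem IsRun.residual₁ (hparam : ParamConditions lam eps tau xi)
    (hrun : Q.IsRun lam eps tau xi X s y θ₁ θ₂) {k : ℕ} (hk : 1 ≤ k) :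
    Q.A (X k) + y k - Q.b = lam k • (θ₁ k - θ₁ (k + 1)) := by
  rw [hrun.update₁ k hk, sub_sub_cancel, smul_inv_smul₀ (hparam.lam_pos k hk).ne']

theorem IsRun.residual₂ (hparam : ParamConditions lam eps tau xi)
    (hrun : Q.IsRun lam eps tau xi X s y θ₁ θ₂) {k : ℕ} (hk : 1 ≤ k) :
    Q.C (X k) + s k - Q.d = lam k • (θ₂ k - θ₂ (k + 1)) := by
  rw [hrun.update₂ k hk, sub_sub_cancel, smul_inv_smul₀ (hparam.lam_pos k hk).ne']

/-- The multipliers of a run are bounded. -/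
theorem IsRun.exists_multiplier_bound
    (hα : Q.α = 1 ∨ Q.α = 2 ∨ Q.α = ∞) (hβ : Q.β = 1 ∨ Q.β = 2 ∨ Q.β = ∞)
    (hμ₁ : 0 ≤ Q.μ₁) (hμ₂ : 0 ≤ Q.μ₂) (hA : Function.Surjective Q.A)
    (hparam : ParamConditions lam eps tau xi)
    (hrun : Q.IsRun lam eps tau xi X s y θ₁ θ₂) :
    ∃ M, 0 ≤ M ∧ ∀ k, 1 ≤ k → ‖θ₁ k‖ ≤ M ∧ ‖θ₂ k‖ ≤ M := by
  obtain ⟨S, hS⟩ := Q.A.exists_rightInverse_of_surjective (LinearMap.range_eq_top.2 hA)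
  have hS' : ∀ u, Q.A (S u) = u := fun u => LinearMap.congr_fun hS u
  obtain ⟨B, hB, hBk⟩ := hparam.eps_bound
  obtain ⟨T, hT⟩ := hparam.tau_ratio.bddAbove_range
  -- `L` is a linear right inverse of `(D, h) ↦ (A D, C D + h)`, so the multipliers can be tested
  -- against arbitrary `(u, v)`.
  let L : EuclideanSpace ℝ (Fin q) × EuclideanSpace ℝ (Fin p) →ₗ[ℝ]
      Matrix (Fin m) (Fin n) ℝ × EuclideanSpace ℝ (Fin p) :=
    (S ∘ₗ LinearMap.fst ℝ _ _).prod
      (LinearMap.snd ℝ _ _ - Q.C ∘ₗ S ∘ₗ LinearMap.fst ℝ _ _)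
  have hL : ∀ u v, L (u, v) = (S u, v - Q.C (S u)) := fun u v => rfl
  obtain ⟨K₁, hK₁, hf⟩ :=
    ((Q.penalty hα hβ hμ₁ hμ₂).comp L).exists_bound_of_finiteDimensional
  obtain ⟨K₂, hK₂, hg⟩ := ((stepSeminorm m n p).comp L).exists_bound_of_finiteDimensional
  have key : ∀ k, 1 ≤ k → ∀ u v, ‖u‖ ≤ 1 → ‖v‖ ≤ 1 →
      inner ℝ (θ₁ (k + 1)) u + inner ℝ (θ₂ (k + 1)) v ≤ K₁ + |T| * K₂ + B + 1 := by
    intro k hk u v hu hv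
    have h := inner_multiplier_le (hα := hα) (hβ := hβ) (hμ₁ := hμ₁) (hμ₂ := hμ₂)
      (hparam.lam_pos k hk) (hrun.augLag_le hparam hk) (S u) (v - Q.C (S u))
    rw [← hrun.update₁ k hk, ← hrun.update₂ k hk, hS', add_sub_cancel, ← hL] at h
    have huv : ‖(u, v)‖ ≤ 1 := by
      rw [Prod.norm_def]; exact max_le hu hv
    have h1 : Q.penalty hα hβ hμ₁ hμ₂ (L (u, v)) ≤ K₁ :=
      (hf (u, v)).trans (mul_le_of_le_one_right hK₁ huv)
    have h2 : stepSeminorm m n p (L (u, v)) ≤ K₂ :=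
      (hg (u, v)).trans (mul_le_of_le_one_right hK₂ huv)
    have h3 : tau k / lam k * stepSeminorm m n p (L (u, v)) ≤ |T| * K₂ :=
      mul_le_mul ((hT ⟨k, rfl⟩).trans (le_abs_self T)) h2 (apply_nonneg _ _) (abs_nonneg _)
    have h4 := hBk k hk
    have h5 : ‖u‖ ^ 2 ≤ 1 := pow_le_one₀ (norm_nonneg _) hu
    have h6 : ‖v‖ ^ 2 ≤ 1 := pow_le_one₀ (norm_nonneg _) hv
    linarith
  have hM : 0 ≤ K₁ + |T| * K₂ + B + 1 := by positivity
  refine ⟨_, hM, fun k hk => ?_⟩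
  rcases hk.eq_or_lt with rfl | hk
  · rw [hrun.init₁, hrun.init₂, norm_zero, norm_zero]
    exact ⟨hM, hM⟩
  · obtain ⟨j, rfl⟩ : ∃ j, k = j + 1 := ⟨k - 1, by omega⟩
    have hj : 1 ≤ j := by omega
    exact ⟨norm_le_of_forall_inner_le hM fun u hu => by simpa using key j hj u 0 hu (by simp),
      norm_le_of_forall_inner_le hM fun v hv => by simpa using key j hj 0 v (by simp) hv⟩

/-- The optimality gap of an iterate, compared with a feasible point. -/
theorem IsRun.mul_penalty_le
    (hα : Q.α = 1 ∨ Q.α = 2 ∨ Q.α = ∞) (hβ : Q.β = 1 ∨ Q.β = 2 ∨ Q.β = ∞)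
    (hγ : Q.γ = 1 ∨ Q.γ = 2 ∨ Q.γ = ∞) (hμ₁ : 0 ≤ Q.μ₁) (hμ₂ : 0 ≤ Q.μ₂)
    (hparam : ParamConditions lam eps tau xi)
    (hrun : Q.IsRun lam eps tau xi X s y θ₁ θ₂) {M : ℝ}
    (hM : ∀ k, 1 ≤ k → ‖θ₁ k‖ ≤ M ∧ ‖θ₂ k‖ ≤ M)
    {Z : Matrix (Fin m) (Fin n) ℝ} (hZ : Z ∈ Q.feasible) {k : ℕ} (hk : 1 ≤ k) :
    lam k * Q.penalty hα hβ hμ₁ hμ₂ (X k, s k) ≤ lam k * Q.objective Z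
      + tau k * stepSeminorm m n p (X k - Z, s k - (Q.d - Q.C Z)) + xi k + eps k
      + lam k ^ 2 * (2 * M ^ 2) := by
  have hlam := hparam.lam_pos k hk
  have htau := hparam.tau_decr.nonneg hk
  have hxi := hparam.xi_decr.nonneg hk
  have heps := hparam.eps_decr.nonneg hk
  have hstep := mul_nonneg htau
    (apply_nonneg (stepSeminorm m n p) (X k - Z, s k - (Q.d - Q.C Z)))
  have hball : vecNorm Q.γ (Q.b - Q.A Z).ofLp ≤ Q.ρ := by
    rw [← vecSeminorm_apply hγ, map_sub_rev, vecSeminorm_apply]; exact hZ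
  have hobj : Q.objective Z = Q.penalty hα hβ hμ₁ hμ₂ (Z, Q.d - Q.C Z) := by
    rw [penalty_apply, objective, ← vecSeminorm_apply hβ, map_sub_rev, vecSeminorm_apply]
  obtain ⟨m₁, m₂⟩ := hM k hk
  obtain ⟨m₁', m₂'⟩ := hM (k + 1) (by omega)
  have hM0 : 0 ≤ M := (norm_nonneg _).trans m₁
  rw [hobj]
  rcases hrun.inner_done k hk with ha | ⟨⟨G, g, hG, hle⟩, hdual, -⟩
  -- At this comparison point both constraint residuals vanish, leaving only `λ²/2 (‖θ₁‖² + ‖θ₂‖²)`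
  -- in the smooth part.
  · have h1 := ha Z (Q.d - Q.C Z) (Q.b - Q.A Z) hball
    rw [augLag_eq (hα := hα) (hβ := hβ) (hμ₁ := hμ₁) (hμ₂ := hμ₂),
      augLag_eq (hα := hα) (hβ := hβ) (hμ₁ := hμ₁) (hμ₂ := hμ₂)] at h1
    have h2 : 0 ≤ Q.smoothPart (lam k) (θ₁ k) (θ₂ k) (X k) (s k) (y k) := by
      rw [smoothPart]; positivity
    have h3 : Q.smoothPart (lam k) (θ₁ k) (θ₂ k) Z (Q.d - Q.C Z) (Q.b - Q.A Z) ≤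
        lam k ^ 2 * (2 * M ^ 2) := by
      rw [smoothPart, add_sub_cancel, add_sub_cancel, sub_self, sub_self, zero_sub, zero_sub,
        norm_neg, norm_neg, norm_smul, norm_smul, mul_pow, mul_pow, Real.norm_of_nonneg hlam.le]
      have e₁ : ‖θ₁ k‖ ^ 2 ≤ M ^ 2 := by gcongr
      have e₂ : ‖θ₂ k‖ ^ 2 ≤ M ^ 2 := by gcongr
      nlinarith [mul_le_mul_of_nonneg_left e₁ (sq_nonneg (lam k)),
        mul_le_mul_of_nonneg_left e₂ (sq_nonneg (lam k)), mul_nonneg (sq_nonneg (lam k))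
        (sq_nonneg M)]
    linarith
  · have h1 := mul_penalty_le_of_augLag_le (hα := hα) (hβ := hβ) (hμ₁ := hμ₁) (hμ₂ := hμ₂)
      hlam.le (hG.augLag_le hle) (Z - X k) (Q.d - Q.C Z - s k)
    rw [add_sub_cancel, add_sub_cancel, ← neg_sub (X k) Z, ← neg_sub (s k),
      ← Prod.neg_mk, map_neg_eq_map (stepSeminorm m n p)] at h1
    rw [gradY_eq] at hdual
    have h2 := neg_inner_le_mul_dualVecNorm hγ
      (Q.A (X k) + y k - Q.b - lam k • θ₁ k) _ hball
    have r₁ := hrun.residual₁ hparam hk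
    have r₂ := hrun.residual₂ hparam hk
    -- Against the gradient, the part `y k - (b - A Z)` costs at most `ξ`, by the dual-norm test and
    -- Hölder; the residual part is treated by `bound`.
    have e₁ : Q.A (-(X k - Z)) = (y k - (Q.b - Q.A Z)) - lam k • (θ₁ k - θ₁ (k + 1)) := by
      rw [← r₁, map_neg, map_sub]; abel
    have e₂ : Q.C (-(X k - Z)) + -(s k - (Q.d - Q.C Z)) = -(lam k • (θ₂ k - θ₂ (k + 1))) := by
      rw [← r₂, map_neg, map_sub]; abel
    rw [e₁, e₂, inner_sub_right, inner_sub_right] at h1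
    -- With `a`, `b` the old and new multipliers, the left side is `λ² ⟨b, a - b⟩`, and `-‖b‖²` is
    -- dropped. Two such terms give `2 * M ^ 2`.
    have bound : ∀ {V : Type} [NormedAddCommGroup V] [InnerProductSpace ℝ V] (a b : V),
        ‖a‖ ≤ M → ‖b‖ ≤ M → -inner ℝ (lam k • (a - b) - lam k • a) (lam k • (a - b)) ≤
          lam k ^ 2 * M ^ 2 := by
      intro V _ _ a b ha hb
      rw [← smul_sub, sub_sub_cancel_left, smul_neg, inner_neg_left, neg_neg, inner_smul_left,
        inner_smul_right, inner_sub_right, real_inner_self_eq_norm_sq]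
      have h3 := real_inner_le_norm b a
      have h4 : ‖b‖ * ‖a‖ ≤ M * M := by gcongr
      simp only [conj_trivial]
      rw [← mul_assoc, ← sq]
      gcongr
      nlinarith [sq_nonneg ‖b‖]
    have b₁ := bound (θ₁ k) (θ₁ (k + 1)) m₁ m₁'
    have b₂ := bound (θ₂ k) (θ₂ (k + 1)) m₂ m₂'
    rw [← r₁] at b₁
    rw [← r₂] at b₂
    rw [inner_neg_right, ← r₁, ← r₂] at h1
    linarith

end

end Problem

end FALC

end

/-! ### Convergence of the whole sequence -/

theorem corollary1 {m n p q : ℕ} (Q : FALC.Problem m n p q)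
    (hα : Q.α = 1 ∨ Q.α = 2 ∨ Q.α = ∞) (hβ : Q.β = 1 ∨ Q.β = 2 ∨ Q.β = ∞)
    (hγ : Q.γ = 1 ∨ Q.γ = 2 ∨ Q.γ = ∞)
    (hμ₁ : 0 ≤ Q.μ₁) (hμ₂ : 0 ≤ Q.μ₂)
    (hA : Function.Surjective Q.A)
    (Xstar : Matrix (Fin m) (Fin n) ℝ) (hopt : Q.IsOptimal Xstar)
    (hunique : ∀ Y : Matrix (Fin m) (Fin n) ℝ, Q.IsOptimal Y → Y = Xstar)
    (lam eps tau xi : ℕ → ℝ) (hparam : FALC.ParamConditions lam eps tau xi)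
    (X : ℕ → Matrix (Fin m) (Fin n) ℝ) (s : ℕ → EuclideanSpace ℝ (Fin p))
    (y : ℕ → EuclideanSpace ℝ (Fin q))
    (θ₁ : ℕ → EuclideanSpace ℝ (Fin q)) (θ₂ : ℕ → EuclideanSpace ℝ (Fin p))
    (hrun : Q.IsRun lam eps tau xi X s y θ₁ θ₂) :
    Tendsto X atTop (𝓝 Xstar) := by
  -- The entrywise sup norm induces the topology of the conclusion; the Frobenius norm enters only
  -- through seminorm bounds.
  let _ := Matrix.normedAddCommGroup (m := Fin m) (n := Fin n) (α := ℝ)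
  let _ := Matrix.normedSpace (m := Fin m) (n := Fin n) (α := ℝ) (R := ℝ)
  obtain ⟨M, hM0, hM⟩ := hrun.exists_multiplier_bound hα hβ hμ₁ hμ₂ hA hparam
  obtain ⟨B, hB, hBk⟩ := hparam.eps_bound
  let f := Q.penalty hα hβ hμ₁ hμ₂
  let V := FALC.vecSeminorm q hγ
  let N : Seminorm ℝ (EuclideanSpace ℝ (Fin p)) :=
    f.comp (LinearMap.inr ℝ (Matrix (Fin m) (Fin n) ℝ) (EuclideanSpace ℝ (Fin p)))
  let stepX : Seminorm ℝ (Matrix (Fin m) (Fin n) ℝ) :=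
    (FALC.stepSeminorm m n p).comp (LinearMap.prod LinearMap.id (-Q.C))
  obtain ⟨Kγ, hKγ, hKγ'⟩ := V.exists_bound_of_finiteDimensional
  obtain ⟨Kβ, hKβ, hKβ'⟩ := N.exists_bound_of_finiteDimensional
  obtain ⟨K, hK, hK'⟩ := stepX.exists_bound_of_finiteDimensional
  have hF : ConvexOn ℝ Set.univ Q.objective := by
    have h := (f.convexOn.translate_left (0, -Q.d)).comp_linearMap
      (LinearMap.prod LinearMap.id Q.C)
    refine (by simpa using h : ConvexOn ℝ Set.univ _).congr fun Z _ => ?_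
    simp [f, FALC.Problem.objective_eq_penalty (hα := hα) (hβ := hβ) (hμ₁ := hμ₁) (hμ₂ := hμ₂),
      sub_eq_add_neg]
  have hg : ConvexOn ℝ Set.univ fun Z => V (Q.A Z - Q.b) := by
    have h := (V.convexOn.translate_left (-Q.b)).comp_linearMap Q.A
    refine (by simpa using h : ConvexOn ℝ Set.univ _).congr fun Z _ => ?_
    simp [sub_eq_add_neg]
  have hlam0 := hparam.lam_decr.2
  -- The bound `ε/λ² ≤ B` gives `ε/λ ≤ B λ`.
  have heps : Tendsto (fun k => eps k / lam k) atTop (𝓝 0) := by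
    refine squeeze_zero' (g := fun k => B * lam k) ?_ ?_ (by simpa using hlam0.const_mul B)
    · filter_upwards [eventually_ge_atTop 1] with k hk
      exact div_nonneg (hparam.eps_decr.nonneg hk) (hparam.lam_pos k hk).le
    · filter_upwards [eventually_ge_atTop 1] with k hk
      have h0 := hparam.lam_pos k hk
      have := mul_le_mul_of_nonneg_right (hBk k hk) h0.le
      refine le_trans (le_of_eq ?_) this
      field_simp
  have hres : ∀ {W : Type} [NormedAddCommGroup W] [NormedSpace ℝ W] (a b : W) (k : ℕ), 1 ≤ k →
      ‖a‖ ≤ M → ‖b‖ ≤ M → ‖lam k • (a - b)‖ ≤ lam k * (2 * M) := by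
    intro W _ _ a b k hk ha hb
    rw [norm_smul, Real.norm_of_nonneg (hparam.lam_pos k hk).le]
    gcongr
    · exact (hparam.lam_pos k hk).le
    · linarith [norm_sub_le a b]
  refine tendsto_of_unique_minimizer hF hg (continuousOn_univ.1 (hF.continuousOn isOpen_univ))
    (continuousOn_univ.1 (hg.continuousOn isOpen_univ)) (ρ := Q.ρ) (x₀ := Xstar) hopt.1
    (fun Z hZ hZF => hunique Z ⟨hZ, fun W hW => hZF.trans (hopt.2 hW)⟩)
    (a := fun k => tau k / lam k * K)
    (e₁ := fun k => Kγ * (lam k * (2 * M)))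
    (e₂ := fun k => tau k / lam k * (lam k * (2 * M)) + xi k / lam k + eps k / lam k
      + lam k * (2 * M ^ 2) + Kβ * (lam k * (2 * M)))
    (by simpa using hparam.tau_ratio.mul_const K)
    (by simpa using (hlam0.mul_const (2 * M)).const_mul Kγ) ?_ ?_ ?_
  · simpa using ((((hparam.tau_ratio.mul (hlam0.mul_const (2 * M))).add hparam.xi_ratio).add
      heps).add (hlam0.mul_const (2 * M ^ 2))).add ((hlam0.mul_const (2 * M)).const_mul Kβ)
  · filter_upwards [eventually_ge_atTop 1] with k hk
    have r₁ := hrun.residual₁ hparam hk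
    have hn := hres _ _ k hk (hM k hk).1 (hM (k + 1) (by omega)).1
    rw [← r₁] at hn
    have h1 : V (Q.A (X k) - Q.b) ≤ V (Q.A (X k) + y k - Q.b) + V (y k) := by
      refine le_trans (le_of_eq (congrArg V ?_)) (map_sub_le_add V _ _)
      abel
    have h2 : V (y k) ≤ Q.ρ := hrun.mem_ball k hk
    have h3 := (hKγ' (Q.A (X k) + y k - Q.b)).trans (mul_le_mul_of_nonneg_left hn hKγ)
    linarith
  · filter_upwards [eventually_ge_atTop 1] with k hk
    have hlam := hparam.lam_pos k hk
    have r₂ := hrun.residual₂ hparam hk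
    have hn := hres _ _ k hk (hM k hk).2 (hM (k + 1) (by omega)).2
    rw [← r₂] at hn
    have h1 := hrun.mul_penalty_le hα hβ hγ hμ₁ hμ₂ hparam hM hopt.1 hk
    have h2 : FALC.stepSeminorm m n p (X k - Xstar, s k - (Q.d - Q.C Xstar)) ≤
        K * ‖X k - Xstar‖ + lam k * (2 * M) := by
      -- The displacement splits into a part linear in `X k - Xstar` and the residual, which is
      -- `O(λ)`.
      have e : (X k - Xstar, s k - (Q.d - Q.C Xstar)) =
          (X k - Xstar, -Q.C (X k - Xstar)) + (0, Q.C (X k) + s k - Q.d) := by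
        ext1
        · simp
        · simp only [Prod.snd_add, map_sub]; abel
      rw [e]
      refine (map_add_le_add _ _ _).trans (add_le_add (hK' (X k - Xstar)) ?_)
      refine le_trans (le_of_eq ?_) hn
      have := map_zero (FALC.frobSeminorm m n)
      rw [FALC.frobSeminorm_apply] at this
      rw [FALC.stepSeminorm_apply, this, zero_add]
    have h3 : Q.objective (X k) ≤ f (X k, s k) + Kβ * (lam k * (2 * M)) := by
      have e : (X k, Q.d - Q.C (X k)) = (X k, s k) - (0, Q.C (X k) + s k - Q.d) := by
        ext1
        · simp
        · simp only [Prod.snd_sub]; abel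
      have e' : Q.objective (X k) = f (X k, Q.d - Q.C (X k)) := by
        rw [FALC.Problem.penalty_apply, FALC.Problem.objective, ← FALC.vecSeminorm_apply hβ,
          map_sub_rev, FALC.vecSeminorm_apply]
      rw [e', e]
      refine (map_sub_le_add f _ _).trans (add_le_add le_rfl ?_)
      exact (hKβ' (Q.C (X k) + s k - Q.d)).trans (mul_le_mul_of_nonneg_left hn hKβ)
    have h4 := mul_le_mul_of_nonneg_left h2 (hparam.tau_decr.nonneg hk)
    have h5 : f (X k, s k) ≤ Q.objective Xstar
        + tau k / lam k * (K * ‖X k - Xstar‖ + lam k * (2 * M)) + xi k / lam k + eps k / lam k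
        + lam k * (2 * M ^ 2) := by
      refine le_of_mul_le_mul_left ?_ hlam
      have e : lam k * (Q.objective Xstar
        + tau k / lam k * (K * ‖X k - Xstar‖ + lam k * (2 * M)) + xi k / lam k + eps k / lam k
        + lam k * (2 * M ^ 2)) = lam k * Q.objective Xstar
        + tau k * (K * ‖X k - Xstar‖ + lam k * (2 * M)) + xi k + eps k
        + lam k ^ 2 * (2 * M ^ 2) := by field_simp
      rw [e]
      change lam k * f (X k, s k) ≤ _ at h1
      linarith
    linarith
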